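/- Let $\psi^{(1)}$ denote the trigamma function, $\psi^{(1)}(z)=\frac{d}{dz}\frac{\Gamma'(z)}{\Gamma(z)}$. The integral $$\int_{0}^{\infty}\frac{\sinh\left(\frac{x}{2}\right)\tanh(x)\,\operatorname{sech}(x)}{x^2+\pi^2}\,dx$$ converges absolutely, and $$\int_{0}^{\infty}\frac{\sinh\left(\frac{x}{2}\right)\tanh(x)\,\operatorname{sech}(x)}{x^2+\pi^2}\,dx =\frac{1}{32\pi^2}\left(\sqrt{2}\left(-\psi^{(1)}\left(\tfrac{3}{8}\right)+\psi^{(1)}\left(\tfrac{5}{8}\right)+\psi^{(1)}\left(\tfrac{7}{8}\right)-\psi^{(1)}\left(\tfrac{9}{8}\right)\right)+16\pi\left(\sqrt{2}+\log\left(\tan\left(\tfrac{\pi}{8}\right)\right)\right)\right).$$ -/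

import Mathlib

/-- The trigamma function `ψ⁽¹⁾`, the derivative of the digamma function `ψ = Γ' / Γ`. -/
noncomputable def trigamma : ℂ → ℂ := deriv Complex.digamma

/-- The hyperbolic secant of a real number. -/
noncomputable def sech (x : ℝ) : ℝ := 1 / Real.cosh x

/-! The integrand is even, so the integral is half the integral over ℝ of `e^{x/2} tanh x sech x /
(x² + π²)`. Writing `π/(x² + π²) = ∫₀^∞ e^{-πt} cos(xt) dt` and applying Fubini reduces it to the
Fourier transform of the weight. That transform is closed: the beta integral and the reflection
formula give `∫ e^{ay}/cosh y dy = π/cos(πa/2)`, integration by parts brings in a factor `a`, and `a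
= 1/2 + it` (`integral_expWeight_mul_cos`). In `s = e^{-πt/2}` the remaining `t`-integral has two
pieces. The cosh piece is rational in `s` and yields `√2 + log tan(π/8)`. The sinh piece is `t(s³ -
s⁵ - s⁷ + s⁹)/(1 - s⁸)`; expanded geometrically, it yields the series `∑ 1/(n + k/8)²`, `k = 3, 5,
7, 9`, which are trigamma values by `trigamma_ofReal`. -/

open MeasureTheory Set Filter Topology

/-! ### Series for digamma and trigamma on the positive reals -/

/-- The logarithmic derivative of the real Gamma function. -/
noncomputable def realDigamma (x : ℝ) : ℝ := deriv (Real.log ∘ Real.Gamma) x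

lemma hasDerivAt_log_Gamma {x : ℝ} (hx : 0 < x) :
    HasDerivAt (Real.log ∘ Real.Gamma) (realDigamma x) x := by
  have hm : ∀ m : ℕ, x ≠ -(m : ℝ) := fun m => by
    have : (0 : ℝ) ≤ m := m.cast_nonneg
    linarith
  exact ((Real.differentiableAt_Gamma hm).log (Real.Gamma_ne_zero hm)).hasDerivAt

lemma log_Gamma_add_one {x : ℝ} (hx : 0 < x) :
    (Real.log ∘ Real.Gamma) (x + 1) = (Real.log ∘ Real.Gamma) x + Real.log x := by
  simp only [Function.comp_apply, Real.Gamma_add_one hx.ne',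
    Real.log_mul hx.ne' (Real.Gamma_pos_of_pos hx).ne', add_comm]

lemma realDigamma_add_one {x : ℝ} (hx : 0 < x) :
    realDigamma (x + 1) = realDigamma x + 1 / x := by
  have h1 : HasDerivAt (fun y => (Real.log ∘ Real.Gamma) (y + 1)) (realDigamma (x + 1)) x :=
    (hasDerivAt_log_Gamma (by linarith : 0 < x + 1)).comp_add_const x 1
  have h2 : HasDerivAt (fun y => (Real.log ∘ Real.Gamma) y + Real.log y)
      (realDigamma x + x⁻¹) x := (hasDerivAt_log_Gamma hx).add (Real.hasDerivAt_log hx.ne')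
  rw [one_div]
  refine h1.unique (h2.congr_of_eventuallyEq ?_)
  filter_upwards [eventually_gt_nhds hx] with y hy using log_Gamma_add_one hy

lemma realDigamma_add_nat {x : ℝ} (hx : 0 < x) (N : ℕ) :
    realDigamma (x + N) = realDigamma x + ∑ n ∈ Finset.range N, 1 / (n + x) := by
  induction N with
  | zero => simp
  | succ N ih =>
    rw [Finset.sum_range_succ, ← add_assoc, ← ih, Nat.cast_succ, ← add_assoc,
      realDigamma_add_one (by positivity), add_comm (N : ℝ) x]

/-- Convexity of `log Γ`: the chord over `[x, x + 1]` has slope `log x`, which lies between the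
tangent slopes at its two ends. This lemma uses the left end, the next one the right. -/
lemma realDigamma_le_log {x : ℝ} (hx : 0 < x) : realDigamma x ≤ Real.log x := by
  have h := Real.convexOn_log_Gamma.le_slope_of_hasDerivAt (mem_Ioi.2 hx)
    (mem_Ioi.2 (by linarith : 0 < x + 1)) (by linarith) (hasDerivAt_log_Gamma hx)
  rwa [slope_def_field, add_sub_cancel_left, div_one, log_Gamma_add_one hx,
    add_sub_cancel_left] at h

lemma log_le_realDigamma_add {x : ℝ} (hx : 0 < x) : Real.log x ≤ realDigamma x + 1 / x := by
  have h := Real.convexOn_log_Gamma.slope_le_of_hasDerivAt (mem_Ioi.2 hx)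
    (mem_Ioi.2 (by linarith : 0 < x + 1)) (by linarith) (hasDerivAt_log_Gamma (by linarith))
  rwa [slope_def_field, add_sub_cancel_left, div_one, log_Gamma_add_one hx,
    add_sub_cancel_left, realDigamma_add_one hx] at h

lemma tendsto_realDigamma_add_nat_sub_log {x : ℝ} (hx : 0 < x) :
    Tendsto (fun N : ℕ => realDigamma (x + N) - Real.log (x + N)) atTop (𝓝 0) := by
  have hN : Tendsto (fun N : ℕ => x + (N : ℝ)) atTop atTop :=
    tendsto_atTop_add_const_left _ _ tendsto_natCast_atTop_atTop
  have hl : Tendsto (fun N : ℕ => -(x + (N : ℝ))⁻¹) atTop (𝓝 0) := by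
    simpa using (tendsto_inv_atTop_zero.comp hN).neg
  refine tendsto_of_tendsto_of_tendsto_of_le_of_le hl tendsto_const_nhds (fun N => ?_)
    (fun N => ?_)
  · have := log_le_realDigamma_add (x := x + N) (by positivity)
    rw [one_div] at this
    dsimp only
    linarith
  · have := realDigamma_le_log (x := x + N) (by positivity)
    dsimp only
    linarith

lemma tendsto_realDigamma_add_nat_sub {x y : ℝ} (hx : 0 < x) (hy : 0 < y) :
    Tendsto (fun N : ℕ => realDigamma (x + N) - realDigamma (y + N)) atTop (𝓝 0) := by
  have hlog : Tendsto (fun N : ℕ => Real.log (x + N) - Real.log (y + N)) atTop (𝓝 0) := by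
    have hd := (Real.tendsto_log_comp_add_sub_log (x - y)).comp
      (tendsto_atTop_add_const_left _ y (tendsto_natCast_atTop_atTop (R := ℝ)))
    refine hd.congr fun N => ?_
    simp only [Function.comp_apply]
    ring_nf
  have h := ((tendsto_realDigamma_add_nat_sub_log hx).sub
    (tendsto_realDigamma_add_nat_sub_log hy)).add hlog
  simp only [sub_zero, add_zero] at h
  exact h.congr fun N => by ring

lemma summable_one_div_nat_add_sq (x : ℝ) : Summable fun n : ℕ => 1 / ((n : ℝ) + x) ^ 2 := by
  have h := (Real.summable_one_div_nat_add_rpow x 2).2 one_lt_two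
  refine h.congr fun n => ?_
  rw [Real.rpow_two, sq_abs]

/-- Telescoping the recurrence gives `ψ(y) - ψ(1) = ∑ (1/(n+1) - 1/(n+y))`, the remainder vanishing
because `ψ(x+N) - ψ(y+N) → 0`; the series is then differentiated termwise. -/
lemma hasDerivAt_realDigamma {x : ℝ} (hx : 0 < x) :
    HasDerivAt realDigamma (∑' n : ℕ, 1 / ((n : ℝ) + x) ^ 2) x := by
  -- The half-line above `c` contains both `x` and the base point 1, where every term is zero, and
  -- the derivatives there are dominated by their values at `c`.
  set c : ℝ := min x 1 / 2 with hc
  have hmin : 0 < min x 1 := lt_min hx one_pos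
  have hc0 : 0 < c := by positivity
  have hcx : c < x := by have := min_le_left x 1; linarith
  have hc1 : c < 1 := by have := min_le_right x 1; linarith
  have hder : ∀ (n : ℕ), ∀ y ∈ Ioi c, HasDerivAt (fun y : ℝ => 1 / ((n : ℝ) + 1) - 1 / (n + y))
      (1 / ((n : ℝ) + y) ^ 2) y := by
    intro n y hy
    have hy0 : 0 < y := hc0.trans hy
    have h := (((hasDerivAt_id y).const_add (n : ℝ)).inv
      (by simp only [id]; positivity)).const_sub (1 / ((n : ℝ) + 1))
    convert! h using 1
    · ext z; simp
    · simp only [id]; ring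
  have hbd : ∀ (n : ℕ), ∀ y ∈ Ioi c, ‖1 / ((n : ℝ) + y) ^ 2‖ ≤ 1 / ((n : ℝ) + c) ^ 2 := by
    intro n y hy
    have hy' : c < y := hy
    have hy0 : 0 < y := hc0.trans hy
    rw [Real.norm_of_nonneg (by positivity)]
    gcongr
  have hs1 : Summable fun n : ℕ => 1 / ((n : ℝ) + 1) - 1 / ((n : ℝ) + 1) := by
    simp
  have hsum : ∀ y ∈ Ioi c, HasSum (fun n : ℕ => 1 / ((n : ℝ) + 1) - 1 / (n + y))
      (realDigamma y - realDigamma 1) := by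
    intro y hy
    have hy0 : 0 < y := hc0.trans hy
    have hs := summable_of_summable_hasDerivAt_of_isPreconnected
      (summable_one_div_nat_add_sq c) isOpen_Ioi isPreconnected_Ioi hder hbd
      (mem_Ioi.2 hc1) hs1 hy
    rw [hs.hasSum_iff_tendsto_nat]
    have ht := (tendsto_realDigamma_add_nat_sub one_pos hy0).add_const
      (realDigamma y - realDigamma 1)
    rw [zero_add] at ht
    refine ht.congr fun N => ?_
    rw [Finset.sum_sub_distrib, realDigamma_add_nat one_pos, realDigamma_add_nat hy0]
    ring
  have hd := hasDerivAt_tsum_of_isPreconnected (summable_one_div_nat_add_sq c) isOpen_Ioi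
    isPreconnected_Ioi hder hbd (mem_Ioi.2 hc1) hs1 (mem_Ioi.2 hcx)
  refine (hd.add_const (realDigamma 1)).congr_of_eventuallyEq ?_
  filter_upwards [Ioi_mem_nhds hcx] with y hy
  rw [(hsum y hy).tsum_eq]
  ring

lemma digamma_ofReal {x : ℝ} (hx : 0 < x) : Complex.digamma (x : ℂ) = (realDigamma x : ℂ) := by
  have hm : ∀ m : ℕ, x ≠ -(m : ℝ) := fun m => by
    have : (0 : ℝ) ≤ m := m.cast_nonneg
    linarith
  have hm' : ∀ m : ℕ, (x : ℂ) ≠ -(m : ℂ) := fun m h => hm m (by exact_mod_cast h)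
  have hR := (Real.differentiableAt_Gamma hm).hasDerivAt
  have hC := (Complex.differentiableAt_Gamma x hm').hasDerivAt.comp_ofReal
  simp only [Complex.Gamma_ofReal] at hC
  have hd : deriv Complex.Gamma x = ((deriv Real.Gamma x : ℝ) : ℂ) :=
    hC.unique hR.ofReal_comp
  have hlog := (hasDerivAt_log_Gamma hx).unique (hR.log (Real.Gamma_ne_zero hm))
  rw [Complex.digamma_def, logDeriv_apply, hd, Complex.Gamma_ofReal, hlog]
  push_cast
  rfl

/-- The series of the trigamma function at positive reals. -/
theorem trigamma_ofReal {x : ℝ} (hx : 0 < x) :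
    trigamma (x : ℂ) = ((∑' n : ℕ, 1 / ((n : ℝ) + x) ^ 2 : ℝ) : ℂ) := by
  have hm' : ∀ m : ℕ, (x : ℂ) ≠ -(m : ℂ) := fun m h => by
    have h' : x = -(m : ℝ) := by exact_mod_cast h
    have : (0 : ℝ) ≤ m := m.cast_nonneg
    linarith
  have hopen : IsOpen {z : ℂ | 0 < z.re} := isOpen_lt continuous_const Complex.continuous_re
  have hG : DifferentiableOn ℂ Complex.Gamma {z : ℂ | 0 < z.re} := fun z hz =>
    (Complex.differentiableAt_Gamma z fun m h => by
      have hz' : 0 < z.re := hz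
      rw [h] at hz'
      have : (0 : ℝ) ≤ m := m.cast_nonneg
      simp at hz'
      linarith).differentiableWithinAt
  have hmem : {z : ℂ | 0 < z.re} ∈ 𝓝 (x : ℂ) := hopen.mem_nhds (by simpa using hx)
  have hdiff : DifferentiableAt ℂ Complex.digamma x :=
    ((hG.deriv hopen).differentiableAt hmem).div (hG.differentiableAt hmem)
      (Complex.Gamma_ne_zero hm')
  -- Digamma is holomorphic near `x`, so its complex derivative is already determined along the real
  -- axis.
  refine hdiff.hasDerivAt.comp_ofReal.unique
    ((hasDerivAt_realDigamma hx).ofReal_comp.congr_of_eventuallyEq ?_)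
  filter_upwards [eventually_gt_nhds hx] with y hy using digamma_ofReal hy

/-! ### Laplace integrals for the trigamma series -/

lemma integral_mul_exp_neg_mul {r : ℝ} (hr : 0 < r) :
    ∫ t in Ioi (0 : ℝ), t * Real.exp (-(r * t)) = 1 / r ^ 2 := by
  have h := Real.integral_rpow_mul_exp_neg_mul_Ioi two_pos hr
  norm_num [Real.Gamma_two] at h
  simpa using h

lemma integrableOn_mul_exp_neg_mul {r : ℝ} (hr : 0 < r) :
    IntegrableOn (fun t => t * Real.exp (-(r * t))) (Ioi 0) :=
  -- A non-integrable function has integral 0 by convention, so a nonzero value proves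
  -- integrability.
  Integrable.of_integral_ne_zero (by rw [integral_mul_exp_neg_mul hr]; positivity)

/-- A Laplace-type integral representation of the trigamma series. -/
lemma integral_mul_exp_div_one_sub_exp {c z : ℝ} (hc : 0 < c) (hz : 0 < z) :
    ∫ t in Ioi (0 : ℝ), t * Real.exp (-(c * z * t)) / (1 - Real.exp (-(c * t))) =
      (1 / c ^ 2) * ∑' n : ℕ, 1 / ((n : ℝ) + z) ^ 2 := by
  have hterm : ∀ n : ℕ, 0 < c * (n + z) := fun n => by positivity
  have hint : ∀ n : ℕ, ∫ t in Ioi (0 : ℝ), t * Real.exp (-(c * (n + z) * t)) =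
      (1 / c ^ 2) * (1 / ((n : ℝ) + z) ^ 2) := fun n => by
    rw [integral_mul_exp_neg_mul (hterm n)]
    field_simp
  have h := hasSum_integral_of_summable_integral_norm
    (μ := volume.restrict (Ioi (0 : ℝ)))
    (F := fun (n : ℕ) (t : ℝ) => t * Real.exp (-(c * (n + z) * t)))
    (fun n => integrableOn_mul_exp_neg_mul (hterm n)) (by
      refine ((summable_one_div_nat_add_sq z).mul_left (1 / c ^ 2)).congr fun n => ?_
      rw [← hint n]
      refine setIntegral_congr_fun measurableSet_Ioi fun t ht => ?_
      have ht' : 0 < t := ht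
      exact (Real.norm_of_nonneg (by positivity)).symm)
  simp only [hint] at h
  rw [← tsum_mul_left, h.tsum_eq]
  refine setIntegral_congr_fun measurableSet_Ioi fun t ht => ?_
  have ht' : 0 < t := ht
  have hlt : Real.exp (-(c * t)) < 1 := by
    rw [Real.exp_lt_one_iff]
    have := mul_pos hc ht'
    linarith
  have hg := (hasSum_geometric_of_lt_one (Real.exp_pos _).le hlt).mul_left
    (t * Real.exp (-(c * z * t)))
  rw [div_eq_mul_inv]
  refine (hg.tsum_eq.symm.trans (tsum_congr fun n => ?_))
  rw [← Real.exp_nat_mul, mul_assoc, ← Real.exp_add]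
  ring_nf

lemma integrableOn_mul_exp_div_one_sub_exp {c z : ℝ} (hc : 0 < c) (hz : 0 < z) :
    IntegrableOn (fun t => t * Real.exp (-(c * z * t)) / (1 - Real.exp (-(c * t)))) (Ioi 0) := by
  refine Integrable.of_integral_ne_zero ?_
  rw [integral_mul_exp_div_one_sub_exp hc hz]
  have := (summable_one_div_nat_add_sq z).tsum_pos (fun n => by positivity) 0 (by positivity)
  positivity

/-! ### Fourier–Laplace transforms of `sech` and `sinh / cosh²` -/

lemma sigmoid_two_mul (y : ℝ) :
    Real.sigmoid (2 * y) = Real.exp (y - Real.log (2 * Real.cosh y)) := by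
  have hc := Real.cosh_pos y
  rw [Real.exp_sub, Real.exp_log (by positivity), Real.sigmoid_def, Real.cosh_eq, two_mul,
    neg_add, Real.exp_add]
  have h := Real.exp_pos y
  rw [Real.exp_neg]
  field_simp

lemma ofReal_exp_cpow (w : ℝ) (s : ℂ) : (Real.exp w : ℂ) ^ s = Complex.exp (w * s) := by
  rw [Complex.cpow_def_of_ne_zero (by exact_mod_cast (Real.exp_pos w).ne'),
    ← Complex.ofReal_log (Real.exp_pos w).le, Real.log_exp]

/-- With `l = log (2 cosh y)`, the substitution `s = sigmoid (2y)` has `s = e^{y-l}` and `1 - s =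
e^{-y-l}`, so the complex powers in the beta integrand become exponentials. -/
lemma beta_integrand_comp_sigmoid (a : ℂ) (y : ℝ) :
    |2 * (Real.sigmoid (2 * y) * (1 - Real.sigmoid (2 * y)))| •
      ((Real.sigmoid (2 * y) : ℂ) ^ ((1 + a) / 2 - 1) *
        (1 - (Real.sigmoid (2 * y) : ℂ)) ^ ((1 - a) / 2 - 1)) =
      Complex.exp (a * y) / (Real.cosh y : ℂ) := by
  have h1 : 1 - Real.sigmoid (2 * y) = Real.exp (-y - Real.log (2 * Real.cosh y)) := by
    rw [← Real.sigmoid_neg, ← mul_neg, sigmoid_two_mul, Real.cosh_neg]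
  have h1' : 1 - (Real.sigmoid (2 * y) : ℂ) =
      (Real.exp (-y - Real.log (2 * Real.cosh y)) : ℂ) := by exact_mod_cast h1
  rw [h1', h1, sigmoid_two_mul, abs_of_pos (by positivity), ofReal_exp_cpow, ofReal_exp_cpow,
    Complex.real_smul]
  have hL : (2 * Real.cosh y : ℂ) = Complex.exp (Real.log (2 * Real.cosh y) : ℝ) := by
    rw [← Complex.ofReal_exp, Real.exp_log (by have := Real.cosh_pos y; positivity)]
    push_cast; rfl
  have hc : (Real.cosh y : ℂ) = Complex.exp (Real.log (2 * Real.cosh y) : ℝ) / 2 := by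
    rw [← hL]; ring
  rw [hc]
  generalize Real.log (2 * Real.cosh y) = l
  push_cast
  rw [div_div_eq_mul_div, eq_div_iff (Complex.exp_ne_zero _)]
  have h2 : Complex.exp (a * y) = Complex.exp (y - l) * Complex.exp (-y - l) *
      (Complex.exp ((y - l) * ((1 + a) / 2 - 1)) * Complex.exp ((-y - l) * ((1 - a) / 2 - 1))) *
      Complex.exp l := by
    simp only [← Complex.exp_add]
    ring_nf
  rw [h2]
  ring

lemma hasDerivAt_sigmoid_two_mul (y : ℝ) : HasDerivAt (fun y => Real.sigmoid (2 * y))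
    (2 * (Real.sigmoid (2 * y) * (1 - Real.sigmoid (2 * y)))) y := by
  have h := (Real.hasDerivAt_sigmoid (2 * y)).comp y ((hasDerivAt_id y).const_mul 2)
  convert! h using 1
  ring

lemma injective_sigmoid_two_mul : Function.Injective fun y : ℝ => Real.sigmoid (2 * y) :=
  Real.sigmoid_injective.comp (mul_right_injective₀ two_ne_zero)

lemma image_sigmoid_two_mul : (fun y : ℝ => Real.sigmoid (2 * y)) '' univ = Ioo 0 1 := by
  rw [image_univ, ← Real.range_sigmoid]
  exact (mul_left_surjective₀ (two_ne_zero (α := ℝ))).range_comp Real.sigmoid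

lemma integrable_exp_mul_div_cosh {a : ℂ} (h1 : -1 < a.re) (h2 : a.re < 1) :
    Integrable fun y : ℝ => Complex.exp (a * y) / (Real.cosh y : ℂ) := by
  have hb := Complex.betaIntegral_convergent (u := (1 + a) / 2) (v := (1 - a) / 2)
    (by simp; linarith) (by simp; linarith)
  rw [intervalIntegrable_iff_integrableOn_Ioo_of_le zero_le_one, ← image_sigmoid_two_mul,
    integrableOn_image_iff_integrableOn_abs_deriv_smul MeasurableSet.univ
      (fun y _ => (hasDerivAt_sigmoid_two_mul y).hasDerivWithinAt)
      injective_sigmoid_two_mul.injOn, integrableOn_univ] at hb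
  simpa only [beta_integrand_comp_sigmoid] using hb

/-- The beta parameters `(1 ± a)/2` sum to 1, so the integral is `Γ(u)Γ(1-u)`, given by the
reflection formula. -/
lemma integral_exp_mul_div_cosh {a : ℂ} (h1 : -1 < a.re) (h2 : a.re < 1) :
    ∫ y : ℝ, Complex.exp (a * y) / (Real.cosh y : ℂ) =
      Real.pi / Complex.cos (Real.pi * a / 2) := by
  have hb := Complex.Gamma_mul_Gamma_eq_betaIntegral (s := (1 + a) / 2) (t := (1 - a) / 2)
    (by simp; linarith) (by simp; linarith)
  have e1 : (1 + a) / 2 + (1 - a) / 2 = 1 := by ring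
  have e2 : (1 - a) / 2 = 1 - (1 + a) / 2 := by ring
  rw [e1, Complex.Gamma_one, one_mul, Complex.betaIntegral,
    intervalIntegral.integral_of_le zero_le_one, integral_Ioc_eq_integral_Ioo,
    ← image_sigmoid_two_mul, integral_image_eq_integral_abs_deriv_smul MeasurableSet.univ
      (fun y _ => (hasDerivAt_sigmoid_two_mul y).hasDerivWithinAt)
      injective_sigmoid_two_mul.injOn, setIntegral_univ] at hb
  simp only [beta_integrand_comp_sigmoid] at hb
  rw [← hb, e2, Complex.Gamma_mul_Gamma_one_sub,
    show (Real.pi : ℂ) * ((1 + a) / 2) = Real.pi * a / 2 + Real.pi / 2 by ring,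
    Complex.sin_add_pi_div_two]

lemma integrable_exp_mul_sinh_div_cosh_sq {a : ℂ} (h1 : -1 < a.re) (h2 : a.re < 1) :
    Integrable fun y : ℝ => Complex.exp (a * y) * ((Real.sinh y / Real.cosh y ^ 2 : ℝ) : ℂ) := by
  have h := (integrable_exp_mul_div_cosh h1 h2).bdd_mul (c := 1)
    (f := fun y : ℝ => ((Real.tanh y : ℝ) : ℂ))
    (by
      refine Continuous.aestronglyMeasurable ?_
      have : Continuous Real.tanh := by
        simp only [funext Real.tanh_eq_sinh_div_cosh]
        exact Real.continuous_sinh.div Real.continuous_cosh fun x => (Real.cosh_pos x).ne'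
      exact Complex.continuous_ofReal.comp this)
    (ae_of_all _ fun y => by
      rw [Complex.norm_real]
      exact (Real.abs_tanh_lt_one y).le)
  refine h.congr (ae_of_all _ fun y => ?_)
  have hc : (Real.cosh y : ℂ) ≠ 0 := by exact_mod_cast (Real.cosh_pos y).ne'
  simp only [Real.tanh_eq_sinh_div_cosh, Complex.ofReal_div, Complex.ofReal_pow]
  field_simp

/-- Integration by parts: the derivative of `e^{ay}/cosh y` integrates to zero. -/
lemma integral_exp_mul_sinh_div_cosh_sq {a : ℂ} (h1 : -1 < a.re) (h2 : a.re < 1) :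
    ∫ y : ℝ, Complex.exp (a * y) * ((Real.sinh y / Real.cosh y ^ 2 : ℝ) : ℂ) =
      a * (Real.pi / Complex.cos (Real.pi * a / 2)) := by
  have hi := integrable_exp_mul_div_cosh h1 h2
  have hs := integrable_exp_mul_sinh_div_cosh_sq h1 h2
  have hder : ∀ y : ℝ, HasDerivAt (fun y : ℝ => Complex.exp (a * y) / (Real.cosh y : ℂ))
      (a * (Complex.exp (a * y) / (Real.cosh y : ℂ)) -
        Complex.exp (a * y) * ((Real.sinh y / Real.cosh y ^ 2 : ℝ) : ℂ)) y := by
    intro y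
    have hc : (Real.cosh y : ℂ) ≠ 0 := by exact_mod_cast (Real.cosh_pos y).ne'
    have hid : HasDerivAt (fun y : ℝ => (y : ℂ)) 1 y := Complex.ofRealCLM.hasDerivAt
    have h := ((hid.const_mul a).cexp).div (Real.hasDerivAt_cosh y).ofReal_comp hc
    convert! h using 1
    push_cast at hc ⊢
    field_simp
  have h0 := integral_eq_zero_of_hasDerivAt_of_integrable hder ((hi.const_mul a).sub hs) hi
  rw [integral_sub (hi.const_mul a) hs, integral_const_mul, sub_eq_zero,
    integral_exp_mul_div_cosh h1 h2] at h0
  exact h0.symm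

lemma re_exp_add_mul_I_mul (p q y : ℝ) :
    (Complex.exp ((p + q * Complex.I) * y)).re = Real.exp (p * y) * Real.cos (q * y) := by
  rw [Complex.exp_re]
  simp

/-- Here `cos(π/4 + iπt/2) = (C - iS)/√2` with `C, S = cosh, sinh (πt/2)`; multiplying by the
conjugate leaves `C² + S² = cosh(πt)` below. -/
lemma mul_pi_div_cos_eq (t : ℝ) :
    ((1 / 2 : ℝ) + t * Complex.I) *
        (Real.pi / Complex.cos (Real.pi * ((1 / 2 : ℝ) + t * Complex.I) / 2)) =
      ((Real.sqrt 2 * Real.pi * ((1 / 2) * Real.cosh (Real.pi * t / 2) -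
          t * Real.sinh (Real.pi * t / 2)) / Real.cosh (Real.pi * t) : ℝ) : ℂ) +
        ((Real.sqrt 2 * Real.pi * ((1 / 2) * Real.sinh (Real.pi * t / 2) +
          t * Real.cosh (Real.pi * t / 2)) / Real.cosh (Real.pi * t) : ℝ) : ℂ) * Complex.I := by
  have harg : (Real.pi : ℂ) * ((1 / 2 : ℝ) + t * Complex.I) / 2 =
      ((Real.pi / 4 : ℝ) : ℂ) + ((Real.pi * t / 2 : ℝ) : ℂ) * Complex.I := by
    push_cast; ring
  have h2y : Real.cosh (Real.pi * t) =
      Real.cosh (Real.pi * t / 2) ^ 2 + Real.sinh (Real.pi * t / 2) ^ 2 := by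
    rw [← Real.cosh_two_mul]; ring_nf
  have hC := Real.cosh_pos (Real.pi * t / 2)
  rw [harg, Complex.cos_add_mul_I, ← Complex.ofReal_cos, ← Complex.ofReal_sin,
    ← Complex.ofReal_cosh, ← Complex.ofReal_sinh, Real.cos_pi_div_four, Real.sin_pi_div_four,
    h2y]
  generalize Real.cosh (Real.pi * t / 2) = C at *
  generalize Real.sinh (Real.pi * t / 2) = S at *
  have hs : (Real.sqrt 2 : ℂ) ^ 2 = 2 := by
    rw [← Complex.ofReal_pow, Real.sq_sqrt (by norm_num)]; norm_num
  have hs0 : (Real.sqrt 2 : ℂ) ≠ 0 := by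
    intro h; rw [h] at hs; norm_num at hs
  have hne : (C : ℂ) - S * Complex.I ≠ 0 := by
    intro h
    have := congrArg Complex.re h
    simp at this
    exact hC.ne' this
  have hne' : (C : ℂ) ^ 2 + (S : ℂ) ^ 2 ≠ 0 := by
    have : C ^ 2 + S ^ 2 ≠ 0 := by positivity
    exact_mod_cast this
  push_cast
  have hquot : (Real.pi : ℂ) / (Real.sqrt 2 / 2 * C - Real.sqrt 2 / 2 * S * Complex.I) =
      Real.sqrt 2 * Real.pi * (C + S * Complex.I) / (C ^ 2 + S ^ 2) := by
    rw [show (Real.sqrt 2 : ℂ) / 2 * C - Real.sqrt 2 / 2 * S * Complex.I =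
      Real.sqrt 2 / 2 * (C - S * Complex.I) by ring,
      div_eq_div_iff (mul_ne_zero (div_ne_zero hs0 two_ne_zero) hne) hne']
    linear_combination (-(Real.pi / 2 : ℂ) * (C ^ 2 + S ^ 2)) * hs +
      ((Real.sqrt 2 : ℂ) ^ 2 / 2 * Real.pi * S ^ 2) * Complex.I_sq
  rw [hquot]
  linear_combination
    (t * Real.sqrt 2 * Real.pi * S / (C ^ 2 + S ^ 2) : ℂ) * Complex.I_sq

/-! ### Reduction of the integral by symmetry and Fubini -/

/-- The real weight `e^{x/2} tanh x sech x`. -/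
noncomputable def expWeight (x : ℝ) : ℝ :=
  Real.exp (1 / 2 * x) * (Real.sinh x / Real.cosh x ^ 2)

lemma re_exp_mul_weight (t x : ℝ) :
    (Complex.exp (((1 / 2 : ℝ) + t * Complex.I) * x) *
      ((Real.sinh x / Real.cosh x ^ 2 : ℝ) : ℂ)).re = expWeight x * Real.cos (t * x) := by
  rw [Complex.re_mul_ofReal, re_exp_add_mul_I_mul, expWeight]
  ring

lemma integrable_expWeight : Integrable expWeight := by
  have h := (integrable_exp_mul_sinh_div_cosh_sq (a := (1 / 2 : ℝ) + (0 : ℝ) * Complex.I)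
    (by norm_num) (by norm_num)).re
  refine h.congr (ae_of_all _ fun x => ?_)
  have := re_exp_mul_weight 0 x
  simpa using this

lemma integral_expWeight_mul_cos (t : ℝ) :
    ∫ x, expWeight x * Real.cos (t * x) =
      Real.sqrt 2 * Real.pi * ((1 / 2) * Real.cosh (Real.pi * t / 2) -
          t * Real.sinh (Real.pi * t / 2)) / Real.cosh (Real.pi * t) := by
  have h1 : -1 < ((1 / 2 : ℝ) + t * Complex.I : ℂ).re := by norm_num
  have h2 : ((1 / 2 : ℝ) + t * Complex.I : ℂ).re < 1 := by norm_num
  have h := congrArg Complex.re (integral_exp_mul_sinh_div_cosh_sq h1 h2)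
  rw [mul_pi_div_cos_eq, Complex.add_re, Complex.re_ofReal_mul, Complex.I_re, mul_zero,
    add_zero, Complex.ofReal_re] at h
  rw [← h]
  have hre := integral_re (integrable_exp_mul_sinh_div_cosh_sq h1 h2)
  simp only [RCLike.re_eq_complex_re] at hre
  rw [← hre]
  simp only [re_exp_mul_weight]

lemma integral_exp_neg_mul_cos {p : ℝ} (hp : 0 < p) (x : ℝ) :
    ∫ t in Ioi (0 : ℝ), Real.exp (-p * t) * Real.cos (x * t) = p / (x ^ 2 + p ^ 2) := by
  have ha : ((-p : ℝ) + x * Complex.I : ℂ).re < 0 := by simpa using hp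
  have hre := integral_re (integrableOn_exp_mul_complex_Ioi ha 0)
  rw [integral_exp_mul_complex_Ioi ha] at hre
  simp only [RCLike.re_eq_complex_re, re_exp_add_mul_I_mul] at hre
  rw [hre]
  simp [Complex.div_re, Complex.normSq_apply]
  ring

/-- The Fubini hypothesis: a product of integrable functions of `x` and of `t`, times a bounded
cosine. -/
lemma integrable_expWeight_mul_exp_mul_cos :
    Integrable (Function.uncurry fun x t : ℝ =>
      expWeight x * (Real.exp (-Real.pi * t) * Real.cos (t * x)))
      (volume.prod (volume.restrict (Ioi 0))) := by
  have hexp : IntegrableOn (fun t => Real.exp (-Real.pi * t)) (Ioi 0) :=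
    integrableOn_exp_mul_Ioi (by simpa using Real.pi_pos) 0
  have h := (integrable_expWeight.mul_prod hexp).bdd_mul (c := 1)
    (f := fun z : ℝ × ℝ => Real.cos (z.2 * z.1))
    (by fun_prop) (ae_of_all _ fun z => Real.abs_cos_le_one _)
  refine h.congr (ae_of_all _ fun z => ?_)
  simp only [Function.uncurry]
  ring

lemma integral_expWeight_div_sq_add_pi_sq :
    ∫ x, expWeight x / (x ^ 2 + Real.pi ^ 2) =
      Real.sqrt 2 * ∫ t in Ioi (0 : ℝ), Real.exp (-Real.pi * t) *
        ((1 / 2) * Real.cosh (Real.pi * t / 2) - t * Real.sinh (Real.pi * t / 2)) /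
          Real.cosh (Real.pi * t) := by
  have hswap := integral_integral_swap integrable_expWeight_mul_exp_mul_cos
  have hl : ∀ x : ℝ, ∫ t in Ioi (0 : ℝ),
      expWeight x * (Real.exp (-Real.pi * t) * Real.cos (t * x)) =
        Real.pi * (expWeight x / (x ^ 2 + Real.pi ^ 2)) := fun x => by
    simp only [mul_comm _ x]
    rw [integral_const_mul, integral_exp_neg_mul_cos Real.pi_pos]
    ring
  have hr : ∀ t : ℝ, ∫ x, expWeight x * (Real.exp (-Real.pi * t) * Real.cos (t * x)) =
      Real.pi * (Real.sqrt 2 * (Real.exp (-Real.pi * t) *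
        ((1 / 2) * Real.cosh (Real.pi * t / 2) - t * Real.sinh (Real.pi * t / 2)) /
          Real.cosh (Real.pi * t))) := fun t => by
    simp only [mul_left_comm _ (Real.exp (-Real.pi * t)) _]
    rw [integral_const_mul, integral_expWeight_mul_cos]
    ring
  simp only [hl, hr] at hswap
  rw [integral_const_mul, integral_const_mul, integral_const_mul] at hswap
  exact mul_left_cancel₀ Real.pi_ne_zero hswap

lemma integrand_eq_symmetrization (x : ℝ) :
    Real.sinh (x / 2) * Real.tanh x * sech x / (x ^ 2 + Real.pi ^ 2) =
      1 / 2 * (expWeight x / (x ^ 2 + Real.pi ^ 2) +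
        expWeight (-x) / ((-x) ^ 2 + Real.pi ^ 2)) := by
  have hc := (Real.cosh_pos x).ne'
  simp only [expWeight, sech, Real.tanh_eq_sinh_div_cosh, Real.sinh_neg, Real.cosh_neg, neg_sq,
    Real.sinh_eq (x / 2)]
  rw [show 1 / 2 * -x = -(x / 2) by ring, show 1 / 2 * x = x / 2 by ring]
  field_simp
  ring

lemma integrable_expWeight_div : Integrable fun x => expWeight x / (x ^ 2 + Real.pi ^ 2) := by
  have hne : ∀ x : ℝ, 0 < x ^ 2 + Real.pi ^ 2 := fun x => by positivity
  have h := integrable_expWeight.bdd_mul (c := 1) (f := fun x : ℝ => 1 / (x ^ 2 + Real.pi ^ 2))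
    (Continuous.aestronglyMeasurable
      (Continuous.div (by fun_prop) (by fun_prop) fun x => (hne x).ne'))
    (ae_of_all _ fun x => by
      rw [Real.norm_of_nonneg (one_div_nonneg.2 (hne x).le), div_le_one (hne x)]
      nlinarith [Real.pi_gt_three, sq_nonneg x])
  refine h.congr (ae_of_all _ fun x => ?_)
  ring

lemma integrableOn_integrand :
    IntegrableOn (fun x : ℝ => Real.sinh (x / 2) * Real.tanh x * sech x / (x ^ 2 + Real.pi ^ 2))
      (Ioi 0) := by
  simp only [integrand_eq_symmetrization]
  exact ((integrable_expWeight_div.add integrable_expWeight_div.comp_neg).const_mul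
    (1 / 2)).integrableOn

lemma integral_integrand :
    ∫ x in Ioi (0 : ℝ), Real.sinh (x / 2) * Real.tanh x * sech x / (x ^ 2 + Real.pi ^ 2) =
      1 / 2 * ∫ x, expWeight x / (x ^ 2 + Real.pi ^ 2) := by
  have hi := integrable_expWeight_div
  simp only [integrand_eq_symmetrization]
  rw [integral_const_mul, integral_add hi.integrableOn hi.comp_neg.integrableOn,
    integral_comp_neg_Ioi (f := fun x => expWeight x / (x ^ 2 + Real.pi ^ 2)), neg_zero,
    add_comm, intervalIntegral.integral_Iic_add_Ioi hi.integrableOn hi.integrableOn]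

/-! ### The cosh piece: an elementary integral -/

/-- An antiderivative of `s² (1 + s²) / (1 + s⁴)`. -/
noncomputable def quarticPrimitive (s : ℝ) : ℝ :=
  s - 1 / (2 * Real.sqrt 2) *
    (Real.log (s ^ 2 + Real.sqrt 2 * s + 1) - Real.log (s ^ 2 - Real.sqrt 2 * s + 1))

lemma hasDerivAt_quarticPrimitive (s : ℝ) :
    HasDerivAt quarticPrimitive (s ^ 2 * (1 + s ^ 2) / (1 + s ^ 4)) s := by
  have hr : Real.sqrt 2 ^ 2 = 2 := Real.sq_sqrt (by norm_num)
  have hr0 : Real.sqrt 2 ≠ 0 := by positivity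
  have h1 : 0 < s ^ 2 + Real.sqrt 2 * s + 1 := by nlinarith [sq_nonneg (s * Real.sqrt 2 + 1)]
  have h2 : 0 < s ^ 2 - Real.sqrt 2 * s + 1 := by nlinarith [sq_nonneg (s * Real.sqrt 2 - 1)]
  have hid := hasDerivAt_id s
  have hp := (((hid.pow 2).add (hid.const_mul (Real.sqrt 2))).add_const 1).log h1.ne'
  have hm := (((hid.pow 2).sub (hid.const_mul (Real.sqrt 2))).add_const 1).log h2.ne'
  have h := hid.sub ((hp.sub hm).const_mul (1 / (2 * Real.sqrt 2)))
  convert! h using 1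
  simp only [id, Pi.pow_apply, Pi.add_apply, Pi.sub_apply]
  have h4 : 0 < 1 + s ^ 4 := by positivity
  -- The factorization of `1 + s⁴` that combines the two logarithmic derivatives.
  have hfac : (s ^ 2 + Real.sqrt 2 * s + 1) * (s ^ 2 - Real.sqrt 2 * s + 1) = 1 + s ^ 4 := by
    linear_combination (-s ^ 2) * hr
  rw [div_sub_div _ _ h1.ne' h2.ne', hfac]
  field_simp
  push_cast
  ring_nf

lemma log_tan_pi_div_eight :
    Real.log (Real.tan (Real.pi / 8)) =
      -(1 / 2) * (Real.log (2 + Real.sqrt 2) - Real.log (2 - Real.sqrt 2)) := by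
  have h2 : Real.sqrt 2 < 2 := by
    rw [Real.sqrt_lt' two_pos]; norm_num
  have hm : 0 < 2 - Real.sqrt 2 := by linarith
  have hp : 0 < 2 + Real.sqrt 2 := by positivity
  rw [Real.tan_eq_sin_div_cos, Real.sin_pi_div_eight, Real.cos_pi_div_eight,
    div_div_div_cancel_right₀ two_ne_zero,
    Real.log_div (Real.sqrt_pos.2 hm).ne' (Real.sqrt_pos.2 hp).ne', Real.log_sqrt hm.le,
    Real.log_sqrt hp.le]
  ring

lemma hasDerivAt_exp_neg_pi_half (t : ℝ) : HasDerivAt (fun t => Real.exp (-(Real.pi / 2) * t))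
    (-(Real.pi / 2) * Real.exp (-(Real.pi / 2) * t)) t := by
  have h := ((hasDerivAt_id t).const_mul (-(Real.pi / 2))).exp
  convert! h using 1
  simp [mul_comm]

lemma hyperbolic_eq_exp_neg (t : ℝ) :
    Real.exp (-Real.pi * t) = Real.exp (-(Real.pi / 2) * t) ^ 2 ∧
    Real.cosh (Real.pi * t / 2) =
      (Real.exp (-(Real.pi / 2) * t) + (Real.exp (-(Real.pi / 2) * t))⁻¹) / 2 ∧
    Real.sinh (Real.pi * t / 2) =
      ((Real.exp (-(Real.pi / 2) * t))⁻¹ - Real.exp (-(Real.pi / 2) * t)) / 2 ∧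
    Real.cosh (Real.pi * t) =
      (Real.exp (-(Real.pi / 2) * t) ^ 2 + (Real.exp (-(Real.pi / 2) * t) ^ 2)⁻¹) / 2 := by
  refine ⟨?_, ?_, ?_, ?_⟩
  · rw [← Real.exp_nat_mul]; ring_nf
  · rw [Real.cosh_eq, ← Real.exp_neg]; ring_nf
  · rw [Real.sinh_eq, ← Real.exp_neg]; ring_nf
  · rw [Real.cosh_eq, ← Real.exp_nat_mul, ← Real.exp_neg]; push_cast; ring_nf

lemma integrableOn_and_integral_cosh_part :
    IntegrableOn (fun t => Real.exp (-Real.pi * t) * Real.cosh (Real.pi * t / 2) /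
      Real.cosh (Real.pi * t)) (Ioi 0) ∧
    ∫ t in Ioi (0 : ℝ), Real.exp (-Real.pi * t) * Real.cosh (Real.pi * t / 2) /
      Real.cosh (Real.pi * t) =
      Real.sqrt 2 / Real.pi * (Real.sqrt 2 + Real.log (Real.tan (Real.pi / 8))) := by
  -- Substituting `s = e^{-πt/2}`, with `dt = -(2/π) ds/s`, turns the integrand into `s²(1 + s²)/(1
  -- + s⁴)`.
  have hder : ∀ t ∈ Ici (0 : ℝ),
      HasDerivAt (fun t => -(2 / Real.pi) * quarticPrimitive (Real.exp (-(Real.pi / 2) * t)))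
        (Real.exp (-Real.pi * t) * Real.cosh (Real.pi * t / 2) / Real.cosh (Real.pi * t)) t := by
    intro t _
    have h := ((hasDerivAt_quarticPrimitive _).comp t (hasDerivAt_exp_neg_pi_half t)).const_mul
      (-(2 / Real.pi))
    convert! h using 1
    obtain ⟨e1, e2, -, e4⟩ := hyperbolic_eq_exp_neg t
    rw [e1, e2, e4]
    have hs := Real.exp_pos (-(Real.pi / 2) * t)
    generalize Real.exp (-(Real.pi / 2) * t) = s at *
    field_simp
    ring
  have hnn : ∀ t ∈ Ioi (0 : ℝ), 0 ≤ Real.exp (-Real.pi * t) * Real.cosh (Real.pi * t / 2) /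
      Real.cosh (Real.pi * t) := fun t _ => by
    have := Real.cosh_pos (Real.pi * t)
    have := Real.cosh_pos (Real.pi * t / 2)
    positivity
  have hlim : Tendsto
      (fun t => -(2 / Real.pi) * quarticPrimitive (Real.exp (-(Real.pi / 2) * t))) atTop
      (𝓝 0) := by
    have hs : Tendsto (fun t => Real.exp (-(Real.pi / 2) * t)) atTop (𝓝 0) :=
      Real.tendsto_exp_atBot.comp
        (tendsto_id.const_mul_atTop_of_neg (by simpa using Real.pi_pos))
    have hk := ((hasDerivAt_quarticPrimitive 0).continuousAt.tendsto.comp hs).const_mul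
      (-(2 / Real.pi))
    simpa [quarticPrimitive] using hk
  refine ⟨integrableOn_Ioi_deriv_of_nonneg' hder hnn hlim, ?_⟩
  rw [integral_Ioi_of_hasDerivAt_of_nonneg' hder hnn hlim, log_tan_pi_div_eight]
  have hr : Real.sqrt 2 ^ 2 = 2 := Real.sq_sqrt (by norm_num)
  have hr0 : Real.sqrt 2 ≠ 0 := by positivity
  simp only [quarticPrimitive, mul_zero, Real.exp_zero, one_pow, mul_one]
  rw [show 1 + Real.sqrt 2 + 1 = 2 + Real.sqrt 2 by ring,
    show 1 - Real.sqrt 2 + 1 = 2 - Real.sqrt 2 by ring]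
  field_simp
  linear_combination
    (-2 * Real.sqrt 2 + Real.log (2 + Real.sqrt 2) - Real.log (2 - Real.sqrt 2)) * hr

/-! ### The sinh piece and the final assembly -/

/-- The trigamma series at a real argument. -/
noncomputable def trigammaSeries (x : ℝ) : ℝ := ∑' n : ℕ, 1 / ((n : ℝ) + x) ^ 2

lemma integrableOn_and_integral_sinh_part :
    IntegrableOn (fun t => t * (Real.exp (-Real.pi * t) * Real.sinh (Real.pi * t / 2) /
      Real.cosh (Real.pi * t))) (Ioi 0) ∧
    ∫ t in Ioi (0 : ℝ), t * (Real.exp (-Real.pi * t) * Real.sinh (Real.pi * t / 2) /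
      Real.cosh (Real.pi * t)) =
      1 / (16 * Real.pi ^ 2) * (trigammaSeries (3 / 8) - trigammaSeries (5 / 8) -
        trigammaSeries (7 / 8) + trigammaSeries (9 / 8)) := by
  have hc : 0 < 4 * Real.pi := by positivity
  -- In `s = e^{-πt/2}` the quotient is `s³(1 - s²)/(1 + s⁴)`. Multiplying above and below by `1 -
  -- s⁴` makes the denominator `1 - s⁸`, whence `c = 4π` and the eighths.
  have hdec : ∀ t ∈ Ioi (0 : ℝ),
      t * (Real.exp (-Real.pi * t) * Real.sinh (Real.pi * t / 2) / Real.cosh (Real.pi * t)) =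
      t * Real.exp (-(4 * Real.pi * (3 / 8) * t)) / (1 - Real.exp (-(4 * Real.pi * t))) -
      t * Real.exp (-(4 * Real.pi * (5 / 8) * t)) / (1 - Real.exp (-(4 * Real.pi * t))) -
      t * Real.exp (-(4 * Real.pi * (7 / 8) * t)) / (1 - Real.exp (-(4 * Real.pi * t))) +
      t * Real.exp (-(4 * Real.pi * (9 / 8) * t)) / (1 - Real.exp (-(4 * Real.pi * t))) := by
    intro t ht
    have ht' : 0 < t := ht
    have hpow : ∀ n : ℕ, Real.exp (-((n : ℝ) * (Real.pi / 2 * t))) =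
        Real.exp (-(Real.pi / 2) * t) ^ n := fun n => by
      rw [← Real.exp_nat_mul]; ring_nf
    obtain ⟨e1, -, e3, e4⟩ := hyperbolic_eq_exp_neg t
    rw [e1, e3, e4,
      show 4 * Real.pi * (3 / 8) * t = (3 : ℕ) * (Real.pi / 2 * t) by push_cast; ring,
      show 4 * Real.pi * (5 / 8) * t = (5 : ℕ) * (Real.pi / 2 * t) by push_cast; ring,
      show 4 * Real.pi * (7 / 8) * t = (7 : ℕ) * (Real.pi / 2 * t) by push_cast; ring,
      show 4 * Real.pi * (9 / 8) * t = (9 : ℕ) * (Real.pi / 2 * t) by push_cast; ring,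
      show 4 * Real.pi * t = (8 : ℕ) * (Real.pi / 2 * t) by push_cast; ring]
    simp only [hpow]
    have hs := Real.exp_pos (-(Real.pi / 2) * t)
    have hs1 : Real.exp (-(Real.pi / 2) * t) < 1 := by
      rw [Real.exp_lt_one_iff]
      have : 0 < Real.pi / 2 * t := by positivity
      linarith
    generalize Real.exp (-(Real.pi / 2) * t) = s at *
    have h8 : 1 - s ^ 8 ≠ 0 := (sub_pos.2 (pow_lt_one₀ hs.le hs1 (by norm_num))).ne'
    field_simp
    ring
  have hi := fun {z : ℝ} (hz : 0 < z) => integrableOn_mul_exp_div_one_sub_exp hc hz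
  have i3 := hi (show (0 : ℝ) < 3 / 8 by norm_num)
  have i5 := hi (show (0 : ℝ) < 5 / 8 by norm_num)
  have i7 := hi (show (0 : ℝ) < 7 / 8 by norm_num)
  have i9 := hi (show (0 : ℝ) < 9 / 8 by norm_num)
  refine ⟨(((i3.sub i5).sub i7).add i9).congr_fun (fun t ht => (hdec t ht).symm)
    measurableSet_Ioi, ?_⟩
  have e1 := integral_add ((i3.sub i5).sub i7) i9
  have e2 := integral_sub (i3.sub i5) i7
  simp only [Pi.sub_apply] at e1 e2
  rw [setIntegral_congr_fun measurableSet_Ioi hdec, e1, e2, integral_sub i3 i5]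
  simp only [trigammaSeries]
  rw [integral_mul_exp_div_one_sub_exp hc (by norm_num),
    integral_mul_exp_div_one_sub_exp hc (by norm_num),
    integral_mul_exp_div_one_sub_exp hc (by norm_num),
    integral_mul_exp_div_one_sub_exp hc (by norm_num)]
  ring

lemma integral_integrand_eq :
    ∫ x in Ioi (0 : ℝ), Real.sinh (x / 2) * Real.tanh x * sech x / (x ^ 2 + Real.pi ^ 2) =
      1 / (32 * Real.pi ^ 2) *
        (Real.sqrt 2 * (-trigammaSeries (3 / 8) + trigammaSeries (5 / 8) +
          trigammaSeries (7 / 8) - trigammaSeries (9 / 8)) +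
        16 * Real.pi * (Real.sqrt 2 + Real.log (Real.tan (Real.pi / 8)))) := by
  obtain ⟨ic, hc⟩ := integrableOn_and_integral_cosh_part
  obtain ⟨is, hs⟩ := integrableOn_and_integral_sinh_part
  have hsplit : ∀ t : ℝ, Real.exp (-Real.pi * t) *
        ((1 / 2) * Real.cosh (Real.pi * t / 2) - t * Real.sinh (Real.pi * t / 2)) /
          Real.cosh (Real.pi * t) =
      1 / 2 * (Real.exp (-Real.pi * t) * Real.cosh (Real.pi * t / 2) / Real.cosh (Real.pi * t)) -
      t * (Real.exp (-Real.pi * t) * Real.sinh (Real.pi * t / 2) /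
        Real.cosh (Real.pi * t)) := fun t => by ring
  rw [integral_integrand, integral_expWeight_div_sq_add_pi_sq]
  simp only [hsplit]
  rw [integral_sub (ic.const_mul (1 / 2)) is, integral_const_mul, hc, hs]
  have hr : Real.sqrt 2 ^ 2 = 2 := Real.sq_sqrt (by norm_num)
  field_simp
  linear_combination
    (512 * Real.pi * (Real.sqrt 2 + Real.log (Real.tan (Real.pi / 8)))) * hr

theorem mainTheorem12 :
    MeasureTheory.IntegrableOn
      (fun x : ℝ => Real.sinh (x / 2) * Real.tanh x * sech x / (x ^ 2 + Real.pi ^ 2))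
      (Set.Ioi 0) MeasureTheory.volume ∧
    ((∫ x in Set.Ioi (0 : ℝ),
        Real.sinh (x / 2) * Real.tanh x * sech x / (x ^ 2 + Real.pi ^ 2) : ℝ) : ℂ) =
      1 / (32 * (Real.pi : ℂ) ^ 2) *
        ((Real.sqrt 2 : ℂ) *
            (-trigamma (3 / 8) + trigamma (5 / 8) + trigamma (7 / 8) - trigamma (9 / 8)) +
          ((16 * Real.pi *
            (Real.sqrt 2 + Real.log (Real.tan (Real.pi / 8))) : ℝ) : ℂ)) := by
  have h3 := trigamma_ofReal (show (0 : ℝ) < 3 / 8 by norm_num)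
  have h5 := trigamma_ofReal (show (0 : ℝ) < 5 / 8 by norm_num)
  have h7 := trigamma_ofReal (show (0 : ℝ) < 7 / 8 by norm_num)
  have h9 := trigamma_ofReal (show (0 : ℝ) < 9 / 8 by norm_num)
  norm_num only [Complex.ofReal_div, Complex.ofReal_ofNat] at h3 h5 h7 h9
  refine ⟨integrableOn_integrand, ?_⟩
  rw [integral_integrand_eq, h3, h5, h7, h9]
  simp only [trigammaSeries]
  push_cast
  ring
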